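/- **Model.** An instance is a pair $(G,\ell)$, where $G=(V,E)$ is a finite nonempty simple graph and $\ell:V\to\{0,1\}^*$; a distributed language is a set of such pairs. Fix a range of identifiers: a function $N:\mathbb N\to\mathbb N$ with $N(n)\ge n$ and $N(n)\le \mathrm{poly}(n)$. In an $n$-node network the nodes are given pairwise distinct identifiers in $\{1,\dots,N(n)\}$, and initially every node knows $n$, its identifier, its label, and the set of identifiers of its neighbors. All nodes run the same synchronous algorithm, with no restriction on local computation. In each round every node sends a (possibly different) bit string to each of its neighbors: of arbitrary length in a LOCAL round, of length $O(\log n)$ in a CONGEST round. After the last round every node accepts or rejects. An algorithm decides $\mathcal L$ if, for every $(G,\ell)$ and every assignment of identifiers, $(G,\ell)\in\mathcal L$ if and only if all nodes accept. A randomized algorithm (whose nodes may use private and shared random coins) decides $\mathcal L$ with error probability at most $\delta$ if, for every $(G,\ell)$ and every assignment of identifiers, all nodes accept with probability at least $1-\delta$ when $(G,\ell)\in\mathcal L$, and at least one node rejects with probability at least $1-\delta$ when $(G,\ell)\notin\mathcal L$. Let $\mathbf{CL}$ (resp. $\mathbf{LC}$) be the class of languages decided by a deterministic algorithm performing one CONGEST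 round followed by one LOCAL round (resp. one LOCAL round followed by one CONGEST round). **The language.** Let $S_n$ be the graph obtained from two disjoint stars with $n$ leaves each by joining their centers $u^*,v^*$ by an edge. DISJ-edge-star is the set of the $(G,\ell)$ such that, for some $n$ and some $x,y\in\{0,1\}^n$ with $x_i\wedge y_i=0$ for all $i\in[n]$, up to isomorphism $G=S_n$, the centers $u^*$ and $v^*$ have an empty label, and, for every $i\in[n]$, exactly one leaf of the first star has label $(x_i,i)$ and exactly one leaf of the second star has label $(y_i,i)$ (a pair $(b,i)\in\{0,1\}\times[n]$ being encoded as the bit $b$ followed by the binary representation of $i$). **Theorem.** $\text{DISJ-edge-star}\in\mathbf{CL}\smallsetminus\mathbf{LC}$; in particular $\mathbf{CL}\smallsetminus\mathbf{LC}\ne\varnothing$. Moreover, for every $\varepsilon>0$, no randomized algorithm performing one LOCAL round followed by one CONGEST round decides DISJ-edge-star with error probability at most $\frac12-\varepsilon$. -/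

import Mathlib

open MeasureTheory

namespace HybridNet

/-- A finite, nonempty simple graph `G` with a label `ℓ(v) ∈ {0,1}*` at every node.
The empty bit string plays the role of the empty label. -/
structure LabeledGraph where
  V : Type
  finite : Finite V
  nonempty : Nonempty V
  G : SimpleGraph V
  label : V → List Bool

/-- The number of nodes of the network. -/
noncomputable def LabeledGraph.size (I : LabeledGraph) : ℕ := Nat.card I.V

/-- A distributed language: a collection of labeled graphs. -/
abbrev Language := Set LabeledGraph

/-! ### Synchronous message-passing algorithms -/

/-- The admissible ranges of identifiers: in an `n`-node network the identifiers are taken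
in `[1, N n]`, where `N n ≥ n` is at most polynomial in `n`. -/
def IsIdRange (N : ℕ → ℕ) : Prop :=
  (∀ n, n ≤ N n) ∧ ∃ p : Polynomial ℕ, ∀ n, N n ≤ p.eval n

/-- `ident` is a one-to-one assignment of identifiers in `[1, N n]`, where `n` is the number of
nodes. -/
def IsIdAssignment (N : ℕ → ℕ) (I : LabeledGraph) (ident : I.V → ℕ) : Prop :=
  Function.Injective ident ∧ ∀ v, 1 ≤ ident v ∧ ident v ≤ N I.size

/-- A (deterministic) distributed algorithm, executed by all the nodes. There is no restriction
on the local computations.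
* `init n k s K` is the initial state of a node with identifier `k` and label `s` in an `n`-node
  network, when `K` is the set of the identifiers of its neighbors;
* `send t q k` is the message that a node in state `q` sends, at round `t` (rounds are numbered
  from `0`), to its neighbor with identifier `k`;
* `recv t q M` is the new state of a node that was in state `q` before round `t`, where `M` is the
  set of the pairs (identifier of the sender, message) received from its neighbors at round `t`;
* `accept q` tells whether a node whose final state is `q` accepts. -/
structure Algorithm where
  State : Type
  init : ℕ → ℕ → List Bool → Set ℕ → State
  send : ℕ → State → ℕ → List Bool
  recv : ℕ → State → Set (ℕ × List Bool) → State
  accept : State → Prop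

/-- The state of every node after the first `t` rounds. -/
noncomputable def Algorithm.state (A : Algorithm) (I : LabeledGraph) (ident : I.V → ℕ) :
    ℕ → I.V → A.State
  | 0, v => A.init I.size (ident v) (I.label v) {k | ∃ w, I.G.Adj v w ∧ k = ident w}
  | t + 1, v => A.recv t (A.state I ident t v)
      {m | ∃ w, I.G.Adj v w ∧ m = (ident w, A.send t (A.state I ident t w) (ident v))}

/-- All the nodes accept after `T` rounds. -/
def Algorithm.AllAccept (A : Algorithm) (T : ℕ) (I : LabeledGraph) (ident : I.V → ℕ) : Prop :=
  ∀ v, A.accept (A.state I ident T v)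

/-- The two kinds of communication rounds between neighbors. -/
inductive RoundKind where
  | LOCAL
  | CONGEST

/-- In the rounds that the schedule `S` declares to be `CONGEST` rounds, every message sent along
an edge has at most `c * ⌊log₂ n⌋` bits in `n`-node networks (an edge exists only if `n ≥ 2`). No
bound is imposed on the size of the messages sent in `LOCAL` rounds. -/
def Algorithm.FitsSchedule (A : Algorithm) (N : ℕ → ℕ) (S : List RoundKind) (c : ℕ) : Prop :=
  ∀ (I : LabeledGraph) (ident : I.V → ℕ), IsIdAssignment N I ident →
    ∀ t, S[t]? = some RoundKind.CONGEST → ∀ v w, I.G.Adj v w →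
      (A.send t (A.state I ident t v) (ident w)).length ≤ c * Nat.log 2 I.size

/-- The languages decided by a deterministic algorithm that performs the rounds of the schedule
`S`: whatever the identifiers, a labeled graph is in the language iff all nodes accept. -/
def HybridClass (N : ℕ → ℕ) (S : List RoundKind) : Set Language :=
  {L | ∃ (A : Algorithm) (c : ℕ), A.FitsSchedule N S c ∧
    ∀ (I : LabeledGraph) (ident : I.V → ℕ), IsIdAssignment N I ident →
      (I ∈ L ↔ A.AllAccept S.length I ident)}

/-- The languages decided with error probability at most `δ` by a randomized algorithm that
performs the rounds of the schedule `S`. The outcome `ω` of the random source is available to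
all nodes (shared coins). Private coins are included: they are obtained when the node with
identifier `k` only uses the component `ω k` of a family of independent coins. -/
def RandHybridClass (N : ℕ → ℕ) (S : List RoundKind) (δ : ℝ) : Set Language :=
  {L | ∃ (Ω : Type) (_ : MeasurableSpace Ω) (μ : Measure Ω) (_ : IsProbabilityMeasure μ)
      (A : Ω → Algorithm) (c : ℕ), (∀ ω, (A ω).FitsSchedule N S c) ∧
    ∀ (I : LabeledGraph) (ident : I.V → ℕ), IsIdAssignment N I ident →
      MeasurableSet {ω | (A ω).AllAccept S.length I ident} ∧
      (I ∈ L → 1 - δ ≤ μ.real {ω | (A ω).AllAccept S.length I ident}) ∧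
      (I ∉ L → 1 - δ ≤ μ.real {ω | ¬ (A ω).AllAccept S.length I ident})}

/-- One `CONGEST` round followed by one `LOCAL` round. -/
def CL (N : ℕ → ℕ) : Set Language := HybridClass N [RoundKind.CONGEST, RoundKind.LOCAL]

/-- One `LOCAL` round followed by one `CONGEST` round. -/
def LC (N : ℕ → ℕ) : Set Language := HybridClass N [RoundKind.LOCAL, RoundKind.CONGEST]

/-- One `LOCAL` round followed by one `CONGEST` round, randomized, error probability at most `δ`. -/
def RandLC (N : ℕ → ℕ) (δ : ℝ) : Set Language :=
  RandHybridClass N [RoundKind.LOCAL, RoundKind.CONGEST] δ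

/-! ### The language DISJ-edge-star -/

/-- Nodes of two stars with `n` leaves each: `(s, none)` is the center of the star `s`, and
`(s, some i)` is its `i`-th leaf. -/
abbrev StarNode (n : ℕ) := Bool × Option (Fin n)

/-- Two stars with `n` leaves each, whose centers are joined by an edge. -/
def joinedStars (n : ℕ) : SimpleGraph (StarNode n) where
  Adj u v := (u.1 ≠ v.1 ∧ u.2 = none ∧ v.2 = none) ∨ (u.1 = v.1 ∧ (u.2 = none ↔ v.2 ≠ none))
  symm := ⟨by
    rintro ⟨a, i⟩ ⟨b, j⟩ h
    simp only at h ⊢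
    tauto⟩
  loopless := ⟨by
    rintro ⟨a, i⟩ h
    simp only at h
    tauto⟩

/-- The label `(b, i) ∈ {0,1} × [n]` as a bit string: the bit `b` followed by the binary
representation of `i`. -/
def leafLabel (b : Bool) (i : ℕ) : List Bool := b :: Nat.bits i

/-- The leaves of the first star hold the pairs `(x_i, i)`, the leaves of the second star hold the
pairs `(y_i, i)`, for `i ∈ {1, …, n}`, and the centers have an empty label. -/
def starLabel {n : ℕ} (x y : Fin n → Bool) : StarNode n → List Bool
  | (_, none) => []
  | (false, some i) => leafLabel (x i) (i + 1)
  | (true, some i) => leafLabel (y i) (i + 1)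

/-- The labeled graphs isomorphic to two joined stars whose leaves hold the bits (with their
indices) of two vectors `x, y ∈ {0,1}ⁿ` that are disjoint. As graphs are considered up to
isomorphism, leaves may be named after the index that they hold. -/
def disjEdgeStar : Language :=
  {I | ∃ (n : ℕ) (x y : Fin n → Bool) (φ : I.G ≃g joinedStars n),
    (∀ v, I.label v = starLabel x y (φ v)) ∧ ∀ i, ¬ (x i = true ∧ y i = true)}

end HybridNet

namespace HybridNet

/-! ### Polynomials of bounded degree are equicontinuous at `0` -/

/-! Membership in CL: the leaves' labels fit in one CONGEST round, so each center learns its star's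
vector, and the LOCAL round carries the whole vector across the middle edge. Each node also checks
its own label and its neighbors' labels. Since the number of nodes is known, a count shows that
these local checks force the whole graph to be two joined stars (`mem_disjEdgeStar_of_local`).

Lower bound: when the LOCAL round comes first, the opposite center has no vector to reveal yet.
Everything that one star learns about the other is then a single message of `O(log n)` bits
(`exists_protocol`), so the accepted pairs form a union of polynomially many disjoint combinatorial
rectangles.

The hard instances have `k` blocks of size `t`: `x` is arbitrary and `V` selects one position per
block, so that disjointness says that all `k` selected bits are `0`. A rectangle has correlation at
most `t ^ (-|S| / 2)` with the character of the selected bits in `S`, by Cauchy–Schwarz and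
orthogonality (`sq_sum_rectangle_le`). With `k` fixed and `t` large, this beats the polynomial
number of rectangles once `|S| ≥ 8 * c + 2`.

Let the selected bits now be independent and equal to `1` with probability `p`. The mean acceptance
probability is a polynomial in `p`, and by the above it is uniformly close on `[0, 1]` to one of
degree less than `8 * c + 2`. It is at least `1/2 + ε` at `p = 0`, and at most `1/2 - ε + (1 - p) ^
k` at `p`. Bounded polynomials of bounded degree cannot drop that fast
(`exists_lipschitz_const_of_degree_lt`): fix a small `p`, then a large `k`, then a large `t`
(`exists_blocks_no_approximation`).

Shared and private coins only average over deterministic algorithms, and the correlation bound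
survives averaging. The deterministic case is error `0`, that is `ε = 1/2`. -/

open Polynomial in
-- Interpolation at the `d` nodes `i / d` writes `Q` as a combination, with coefficients at most
-- `2`, of basis polynomials that do not depend on `Q`; each of these has its own Lipschitz constant
-- at `0`.
theorem exists_lipschitz_const_of_degree_lt (d : ℕ) :
    ∃ C : ℝ, 0 < C ∧ ∀ Q : ℝ[X], Q.degree < d → (∀ p ∈ Set.Icc (0 : ℝ) 1, |Q.eval p| ≤ 2) →
      ∀ p ∈ Set.Icc (0 : ℝ) 1, |Q.eval p - Q.eval 0| ≤ C * p := by
  classical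
  let v : ℕ → ℝ := fun i => (i : ℝ) / d
  let s : Finset ℕ := Finset.range d
  have hv : Set.InjOn v s := by
    intro i hi j hj h
    have hd : (d : ℝ) ≠ 0 := by
      have : i < d := Finset.mem_range.1 hi
      exact_mod_cast (by omega : d ≠ 0)
    simpa [v, div_left_inj' hd] using h
  have key : ∀ L : ℝ[X], ∃ K : ℝ, 0 ≤ K ∧
      ∀ p ∈ Set.Icc (0 : ℝ) 1, |L.eval p - L.eval 0| ≤ K * p := by
    intro L
    obtain ⟨K, hK⟩ := isCompact_Icc.exists_bound_of_continuousOn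
      (s := Set.Icc (0 : ℝ) 1) L.divX.continuous.continuousOn
    refine ⟨K, (norm_nonneg _).trans (hK 0 (by simp)), fun p hp => ?_⟩
    have h := congrArg (eval p) L.divX_mul_X_add
    have h0 : L.eval 0 = L.coeff 0 := by rw [coeff_zero_eq_eval_zero]
    simp only [eval_add, eval_mul, eval_X, eval_C] at h
    rw [← h, h0, add_sub_cancel_right, abs_mul, abs_of_nonneg hp.1]
    exact mul_le_mul_of_nonneg_right (hK p hp) hp.1
  choose K hK0 hK using key
  -- The `+ 1` only makes the constant positive; the sum may vanish.
  refine ⟨∑ i ∈ s, 2 * K (Lagrange.basis s v i) + 1, ?_, fun Q hQ hQ2 p hp => ?_⟩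
  · have : 0 ≤ ∑ i ∈ s, 2 * K (Lagrange.basis s v i) :=
      Finset.sum_nonneg fun i _ => mul_nonneg zero_le_two (hK0 _)
    linarith
  · have hQ' : Q = Lagrange.interpolate s v fun i => Q.eval (v i) :=
      Lagrange.eq_interpolate hv (by simpa [s] using hQ)
    have e : ∀ r, Q.eval r = ∑ i ∈ s, Q.eval (v i) * (Lagrange.basis s v i).eval r := by
      intro r
      conv_lhs => rw [hQ', Lagrange.interpolate_apply, eval_finsetSum]
      simp
    have hb : ∀ i ∈ s, |Q.eval (v i)| ≤ 2 := by
      intro i hi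
      have hi : i < d := Finset.mem_range.1 hi
      refine hQ2 _ ⟨by positivity, ?_⟩
      exact div_le_one_of_le₀ (by exact_mod_cast hi.le) (by positivity)
    calc |Q.eval p - Q.eval 0|
        = |∑ i ∈ s, Q.eval (v i) *
            ((Lagrange.basis s v i).eval p - (Lagrange.basis s v i).eval 0)| := by
          rw [e p, e 0, ← Finset.sum_sub_distrib]
          simp only [mul_sub]
      _ ≤ ∑ i ∈ s, 2 * (K (Lagrange.basis s v i) * p) := by
          refine (Finset.abs_sum_le_sum_abs _ _).trans (Finset.sum_le_sum fun i hi => ?_)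
          rw [abs_mul]
          exact mul_le_mul (hb i hi) (hK _ p hp) (abs_nonneg _) zero_le_two
      _ ≤ _ := by
          rw [add_mul, Finset.sum_mul, one_mul]
          simp only [mul_assoc]
          linarith [hp.1]

/-! ### Characters of the block index function -/

/-- The sign `(-1)ᵇ`. -/
def boolSign (b : Bool) : ℝ := if b then -1 else 1

theorem boolSign_mul_self (b : Bool) : boolSign b * boolSign b = 1 := by
  cases b <;> simp [boolSign]

theorem boolSign_not (b : Bool) : boolSign (!b) = - boolSign b := by
  cases b <;> simp [boolSign]

/-- The character `∏_{j ∈ S} (-1)^{x_{j, V j}}`. -/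
def blockChar {k t : ℕ} (S : Finset (Fin k)) (x : Fin k → Fin t → Bool) (V : Fin k → Fin t) : ℝ :=
  ∏ j ∈ S, boolSign (x j (V j))

section blockChar

variable {k t : ℕ}

/-- Negation of the bit `x_{j, i}`. -/
def flipBit (j : Fin k) (i : Fin t) (x : Fin k → Fin t → Bool) : Fin k → Fin t → Bool :=
  fun j' i' => if j' = j ∧ i' = i then !(x j' i') else x j' i'

theorem flipBit_flipBit (j : Fin k) (i : Fin t) (x : Fin k → Fin t → Bool) :
    flipBit j i (flipBit j i x) = x := by
  funext j' i'
  by_cases h : j' = j ∧ i' = i <;> simp [flipBit, h]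

theorem blockChar_flipBit (S : Finset (Fin k)) (x : Fin k → Fin t → Bool) (V : Fin k → Fin t)
    (j : Fin k) (i : Fin t) :
    blockChar S (flipBit j i x) V = if j ∈ S ∧ V j = i then - blockChar S x V
      else blockChar S x V := by
  unfold blockChar
  have h : ∀ j' ∈ S, boolSign (flipBit j i x j' (V j')) =
      (if j' = j then (if V j = i then -1 else 1) else 1) * boolSign (x j' (V j')) := by
    intro j' _
    by_cases hj : j' = j
    · subst hj
      by_cases hV : V j' = i <;> simp [flipBit, hV, boolSign_not]
    · simp [flipBit, hj]
  rw [Finset.prod_congr rfl h, Finset.prod_mul_distrib, Finset.prod_ite_eq' S j]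
  by_cases hj : j ∈ S <;> by_cases hV : V j = i <;> simp [hj, hV]

theorem sum_eq_zero_of_flipBit (F : (Fin k → Fin t → Bool) → ℝ) (j : Fin k) (i : Fin t)
    (h : ∀ x, F (flipBit j i x) = - F x) : ∑ x, F x = 0 := by
  have e : ∑ x, F (flipBit j i x) = ∑ x, F x :=
    Equiv.sum_comp ⟨flipBit j i, flipBit j i, flipBit_flipBit j i, flipBit_flipBit j i⟩ F
  simp only [h, Finset.sum_neg_distrib] at e
  linarith

theorem sum_blockChar {S : Finset (Fin k)} (hS : S.Nonempty) (V : Fin k → Fin t) :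
    ∑ x, blockChar S x V = 0 := by
  obtain ⟨j, hj⟩ := hS
  refine sum_eq_zero_of_flipBit _ j (V j) fun x => ?_
  simp [blockChar_flipBit, hj]

/-- If `V` and `W` differ at some `j ∈ S`, flipping the bit `x j (V j)` negates the first factor and
leaves the second unchanged. -/
theorem sum_blockChar_mul_blockChar (S : Finset (Fin k)) (V W : Fin k → Fin t) :
    ∑ x, blockChar S x V * blockChar S x W =
      if ∀ j ∈ S, W j = V j then (Fintype.card (Fin k → Fin t → Bool) : ℝ) else 0 := by
  split_ifs with h
  · have : ∀ x, blockChar S x V * blockChar S x W = 1 := by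
      intro x
      rw [blockChar, blockChar, ← Finset.prod_mul_distrib]
      refine Finset.prod_eq_one fun j hj => ?_
      rw [h j hj, boolSign_mul_self]
    simp [this]
  · push Not at h
    obtain ⟨j, hj, hne⟩ := h
    refine sum_eq_zero_of_flipBit _ j (V j) fun x => ?_
    simp [blockChar_flipBit, hj, hne]

theorem card_agree_mul (S : Finset (Fin k)) (V : Fin k → Fin t) :
    (Finset.univ.filter fun W : Fin k → Fin t => ∀ j ∈ S, W j = V j).card * t ^ S.card =
      Fintype.card (Fin k → Fin t) := by
  have e : (Finset.univ.filter fun W : Fin k → Fin t => ∀ j ∈ S, W j = V j) =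
      Fintype.piFinset fun j => if j ∈ S then {V j} else Finset.univ := by
    ext W
    simp only [Finset.mem_filter, Finset.mem_univ, true_and, Fintype.mem_piFinset]
    refine forall_congr' fun j => ?_
    by_cases hj : j ∈ S <;> simp [hj]
  have h1 : ∀ j, (if j ∈ S then ({V j} : Finset (Fin t)) else Finset.univ).card *
      (if j ∈ S then t else 1) = t := by
    intro j
    by_cases hj : j ∈ S <;> simp [hj]
  have h2 : t ^ S.card = ∏ j, (if j ∈ S then t else 1) := by
    simp
  rw [e, Fintype.card_piFinset, h2, ← Finset.prod_mul_distrib, Finset.prod_congr rfl fun j _ => h1 j]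
  simp

/-- A combinatorial rectangle is nearly orthogonal to the characters of high degree. -/
theorem sq_sum_rectangle_le (ht : 0 < t) (S : Finset (Fin k)) (A : (Fin k → Fin t → Bool) → ℝ)
    (B : (Fin k → Fin t) → ℝ) (hA : ∀ x, |A x| ≤ 1) (hB : ∀ V, |B V| ≤ 1) :
    (∑ x, ∑ V, A x * B V * blockChar S x V) ^ 2 ≤
      ((Fintype.card (Fin k → Fin t → Bool) : ℝ) * Fintype.card (Fin k → Fin t)) ^ 2 /
        (t : ℝ) ^ S.card := by
  set X : ℝ := (Fintype.card (Fin k → Fin t → Bool) : ℝ) with hX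
  set Y : ℝ := (Fintype.card (Fin k → Fin t) : ℝ) with hY
  have ht' : (0 : ℝ) < (t : ℝ) ^ S.card := by positivity
  -- Cauchy–Schwarz over `x` removes `A`. In the expanded square, orthogonality keeps only the pairs
  -- `V`, `W` that agree on `S`, a fraction `t ^ (-|S|)` of all pairs.
  have h1 : (∑ x, ∑ V, A x * B V * blockChar S x V) ^ 2 ≤
      X * ∑ x, (∑ V, B V * blockChar S x V) ^ 2 := by
    have : ∀ x, ∑ V, A x * B V * blockChar S x V = A x * ∑ V, B V * blockChar S x V := by
      intro x
      simp only [Finset.mul_sum, mul_assoc]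
    simp only [this]
    refine (Finset.sum_mul_sq_le_sq_mul_sq _ _ _).trans
      (mul_le_mul_of_nonneg_right ?_ (Finset.sum_nonneg fun _ _ => sq_nonneg _))
    calc ∑ x, A x ^ 2 ≤ ∑ x : Fin k → Fin t → Bool, (1 : ℝ) :=
          Finset.sum_le_sum fun x _ => (sq_le_one_iff_abs_le_one _).2 (hA x)
      _ = X := by rw [Finset.sum_const, nsmul_eq_mul, mul_one, hX, Finset.card_univ]
  have h2 : ∑ x, (∑ V, B V * blockChar S x V) ^ 2 =
      ∑ V, ∑ W, B V * B W * if ∀ j ∈ S, W j = V j then X else 0 := by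
    simp only [sq, Finset.sum_mul_sum]
    rw [Finset.sum_comm]
    refine Finset.sum_congr rfl fun V _ => ?_
    rw [Finset.sum_comm]
    refine Finset.sum_congr rfl fun W _ => ?_
    rw [hX, ← sum_blockChar_mul_blockChar, Finset.mul_sum]
    exact Finset.sum_congr rfl fun x _ => by ring
  have h3 : ∑ V, ∑ W, (B V * B W * if ∀ j ∈ S, W j = V j then X else 0) ≤
      ∑ V : Fin k → Fin t, Y / (t : ℝ) ^ S.card * X := by
    refine Finset.sum_le_sum fun V _ => ?_
    have hc := card_agree_mul S V
    have hc' : ((Finset.univ.filter fun W : Fin k → Fin t => ∀ j ∈ S, W j = V j).card : ℝ) =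
        Y / (t : ℝ) ^ S.card := by
      rw [eq_div_iff ht'.ne', hY]
      exact_mod_cast hc
    rw [← hc', ← nsmul_eq_mul, ← Finset.sum_const, Finset.sum_filter]
    refine Finset.sum_le_sum fun W _ => ?_
    split_ifs
    · have : B V * B W ≤ 1 := (le_abs_self _).trans (by
        rw [abs_mul]; exact mul_le_one₀ (hB V) (abs_nonneg _) (hB W))
      exact mul_le_of_le_one_left (Nat.cast_nonneg _) this
    · simp
  calc _ ≤ X * ∑ x, (∑ V, B V * blockChar S x V) ^ 2 := h1
    _ ≤ X * ∑ V : Fin k → Fin t, Y / (t : ℝ) ^ S.card * X := by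
        rw [h2]
        exact mul_le_mul_of_nonneg_left h3 (Nat.cast_nonneg _)
    _ = _ := by
        rw [Finset.sum_const, nsmul_eq_mul, Finset.card_univ, ← hY]
        ring

theorem abs_sum_rectangle_le (ht : 0 < t) (S : Finset (Fin k)) (A : (Fin k → Fin t → Bool) → ℝ)
    (B : (Fin k → Fin t) → ℝ) (hA : ∀ x, |A x| ≤ 1) (hB : ∀ V, |B V| ≤ 1) :
    |∑ x, ∑ V, A x * B V * blockChar S x V| ≤
      (Fintype.card (Fin k → Fin t → Bool) : ℝ) * Fintype.card (Fin k → Fin t) /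
        √((t : ℝ) ^ S.card) := by
  refine abs_le_of_sq_le_sq ?_ (by positivity)
  rw [div_pow, Real.sq_sqrt (by positivity)]
  exact sq_sum_rectangle_le ht S A B hA hB

theorem sum_sum_sum_sum_comm {ι κ M : Type*} [Fintype ι] [Fintype κ] [Fintype M]
    (F : ι → κ → M → M → ℝ) :
    ∑ x, ∑ V, ∑ α, ∑ β, F x V α β = ∑ α, ∑ β, ∑ x, ∑ V, F x V α β := by
  calc ∑ x, ∑ V, ∑ α, ∑ β, F x V α β = ∑ x, ∑ α, ∑ V, ∑ β, F x V α β :=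
        Finset.sum_congr rfl fun x _ => Finset.sum_comm
    _ = ∑ α, ∑ x, ∑ V, ∑ β, F x V α β := Finset.sum_comm
    _ = ∑ α, ∑ x, ∑ β, ∑ V, F x V α β := Finset.sum_congr rfl fun α _ =>
        Finset.sum_congr rfl fun x _ => Finset.sum_comm
    _ = ∑ α, ∑ β, ∑ x, ∑ V, F x V α β := Finset.sum_congr rfl fun α _ => Finset.sum_comm

open Classical in
/-- If the pair `(x, V)` is accepted by two parties that exchange one message of the set `M` each
way, then the indicator of acceptance is nearly orthogonal to the characters of high degree. -/
theorem abs_sum_protocol_le {M : Type*} [Fintype M] (ht : 0 < t) (S : Finset (Fin k))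
    (a : (Fin k → Fin t → Bool) → M) (b : (Fin k → Fin t) → M)
    (f : (Fin k → Fin t → Bool) → M → Prop) (g : (Fin k → Fin t) → M → Prop) :
    |∑ x, ∑ V, (if f x (b V) ∧ g V (a x) then (1 : ℝ) else 0) * blockChar S x V| ≤
      (Fintype.card M : ℝ) ^ 2 * ((Fintype.card (Fin k → Fin t → Bool) : ℝ) *
        Fintype.card (Fin k → Fin t) / √((t : ℝ) ^ S.card)) := by
  -- For each pair of messages `(α, β)`, the accepted pairs with this transcript form a rectangle.
  let A : M → M → (Fin k → Fin t → Bool) → ℝ := fun α β x => if a x = α ∧ f x β then 1 else 0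
  let B : M → M → (Fin k → Fin t) → ℝ := fun α β V => if b V = β ∧ g V α then 1 else 0
  have hA : ∀ α β x, |A α β x| ≤ 1 := by
    intro α β x
    simp only [A]
    split_ifs <;> simp
  have hB : ∀ α β V, |B α β V| ≤ 1 := by
    intro α β V
    simp only [B]
    split_ifs <;> simp
  have e : ∀ x V, (if f x (b V) ∧ g V (a x) then (1 : ℝ) else 0) =
      ∑ α, ∑ β, A α β x * B α β V := by
    intro x V
    rw [Finset.sum_eq_single (a x), Finset.sum_eq_single (b V)]
    · by_cases h1 : f x (b V) <;> by_cases h2 : g V (a x) <;> simp [A, B, h1, h2]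
    · intro β _ h
      simp [B, h.symm]
    · simp
    · intro α _ h
      simp [A, h.symm]
    · simp
  have e2 : ∑ x, ∑ V, (if f x (b V) ∧ g V (a x) then (1 : ℝ) else 0) * blockChar S x V =
      ∑ α, ∑ β, ∑ x, ∑ V, A α β x * B α β V * blockChar S x V := by
    rw [← sum_sum_sum_sum_comm]
    refine Finset.sum_congr rfl fun x _ => Finset.sum_congr rfl fun V _ => ?_
    rw [e, Finset.sum_mul]
    exact Finset.sum_congr rfl fun α _ => Finset.sum_mul _ _ _
  set D : ℝ := (Fintype.card (Fin k → Fin t → Bool) : ℝ) *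
    Fintype.card (Fin k → Fin t) / √((t : ℝ) ^ S.card) with hD
  have hle : ∀ α β, |∑ x, ∑ V, A α β x * B α β V * blockChar S x V| ≤ D := fun α β =>
    abs_sum_rectangle_le ht S (A α β) (B α β) (hA α β) (hB α β)
  rw [e2]
  calc _ ≤ ∑ α, |∑ β, ∑ x, ∑ V, A α β x * B α β V * blockChar S x V| :=
        Finset.abs_sum_le_sum_abs _ _
    _ ≤ ∑ α : M, ∑ β : M, D := Finset.sum_le_sum fun α _ =>
        (Finset.abs_sum_le_sum_abs _ _).trans (Finset.sum_le_sum fun β _ => hle α β)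
    _ = _ := by
        simp only [Finset.sum_const, nsmul_eq_mul, Finset.card_univ]
        ring

/-! ### Averages with respect to biased bits -/

/-- The density, with respect to uniform bits, that makes the bits selected by `V` equal to `1`
with probability `p`. -/
def biasWeight (p : ℝ) (x : Fin k → Fin t → Bool) (V : Fin k → Fin t) : ℝ :=
  ∏ j, (1 + (1 - 2 * p) * boolSign (x j (V j)))

theorem biasWeight_eq_sum (p : ℝ) (x : Fin k → Fin t → Bool) (V : Fin k → Fin t) :
    biasWeight p x V = ∑ S : Finset (Fin k), (1 - 2 * p) ^ S.card * blockChar S x V := by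
  rw [biasWeight, Finset.prod_one_add, Finset.powerset_univ]
  refine Finset.sum_congr rfl fun S _ => ?_
  rw [Finset.prod_mul_distrib, Finset.prod_const, blockChar]

theorem biasWeight_nonneg {p : ℝ} (hp : p ∈ Set.Icc (0 : ℝ) 1) (x : Fin k → Fin t → Bool)
    (V : Fin k → Fin t) : 0 ≤ biasWeight p x V := by
  refine Finset.prod_nonneg fun j _ => ?_
  cases x j (V j) <;> simp only [boolSign] <;> norm_num <;> linarith [hp.1, hp.2]

/-- On disjoint pairs each factor is `2 * (1 - p)` instead of `2`. As the weight for `p = 0` lives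
on these pairs, their total mass under bias `p` is `(1 - p) ^ k`. -/
theorem biasWeight_of_forall_eq_false (p : ℝ) {x : Fin k → Fin t → Bool} {V : Fin k → Fin t}
    (h : ∀ j, x j (V j) = false) : biasWeight p x V = (1 - p) ^ k * biasWeight 0 x V := by
  have : (1 : ℝ) + (1 - 2 * p) * 1 = (1 - p) * (1 + (1 - 2 * 0) * 1) := by ring
  simp only [biasWeight, h, boolSign, Bool.false_eq_true, if_false, this]
  simp [mul_pow]

theorem biasWeight_zero_of_eq_true {x : Fin k → Fin t → Bool} {V : Fin k → Fin t}
    {j : Fin k} (h : x j (V j) = true) : biasWeight 0 x V = 0 := by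
  refine Finset.prod_eq_zero (Finset.mem_univ j) ?_
  simp [h, boolSign]

theorem sum_biasWeight (p : ℝ) (V : Fin k → Fin t) :
    ∑ x, biasWeight p x V = Fintype.card (Fin k → Fin t → Bool) := by
  simp only [biasWeight_eq_sum]
  rw [Finset.sum_comm, Finset.sum_eq_single ∅]
  · simp [blockChar]
  · intro S _ hS
    rw [← Finset.mul_sum, sum_blockChar (Finset.nonempty_iff_ne_empty.2 hS), mul_zero]
  · simp

end blockChar

/-- The left side counts pairs of padded messages on stars with `k * t` leaves. For fixed `k` and
`c` it is polynomial in `t`, with an exponent independent of `k`; this is what lets the degree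
threshold be chosen before `k`. -/
theorem three_pow_log_sq_le (c k t : ℕ) (ht : 0 < t) :
    (3 ^ (c * Nat.log 2 (2 * (k * t + 1)))) ^ 2 ≤ (2 * (k + 1)) ^ (4 * c) * t ^ (4 * c) := by
  set L := Nat.log 2 (2 * (k * t + 1)) with hL
  have h1 : 2 ^ L ≤ 2 * (k * t + 1) := Nat.pow_log_le_self 2 (by positivity)
  have h2 : 2 * (k * t + 1) ≤ 2 * (k + 1) * t := by nlinarith
  calc (3 ^ (c * L)) ^ 2 ≤ (4 ^ (c * L)) ^ 2 := by gcongr; norm_num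
    _ = (2 ^ L) ^ (4 * c) := by
        rw [show 4 = 2 ^ 2 by norm_num, ← pow_mul, ← pow_mul, ← pow_mul]
        congr 1
        ring
    _ ≤ (2 * (k + 1) * t) ^ (4 * c) := Nat.pow_le_pow_left (h1.trans h2) _
    _ = _ := mul_pow _ _ _

/-- The average of `P` over all pairs `(x, V)`, weighted by `biasWeight p`. -/
noncomputable def biasedMean {k t : ℕ} (P : (Fin k → Fin t → Bool) → (Fin k → Fin t) → ℝ) (p : ℝ) :
    ℝ :=
  (∑ x, ∑ V, P x V * biasWeight p x V) /
    ((Fintype.card (Fin k → Fin t → Bool) : ℝ) * Fintype.card (Fin k → Fin t))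

/-- The correlation of `P` with a character. -/
noncomputable def blockCoeff {k t : ℕ} (P : (Fin k → Fin t → Bool) → (Fin k → Fin t) → ℝ)
    (S : Finset (Fin k)) : ℝ :=
  (∑ x, ∑ V, P x V * blockChar S x V) /
    ((Fintype.card (Fin k → Fin t → Bool) : ℝ) * Fintype.card (Fin k → Fin t))

section

variable {k t : ℕ} {P Q : (Fin k → Fin t → Bool) → (Fin k → Fin t) → ℝ}

theorem card_mul_card_pos (k : ℕ) {t : ℕ} (ht : 0 < t) :
    0 < (Fintype.card (Fin k → Fin t → Bool) : ℝ) * Fintype.card (Fin k → Fin t) := by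
  have : Nonempty (Fin t) := ⟨⟨0, ht⟩⟩
  have h1 : 0 < Fintype.card (Fin k → Fin t → Bool) := Fintype.card_pos
  have h2 : 0 < Fintype.card (Fin k → Fin t) := Fintype.card_pos
  positivity

theorem biasedMean_const (ht : 0 < t) (a p : ℝ) :
    biasedMean (fun (_ : Fin k → Fin t → Bool) (_ : Fin k → Fin t) => a) p = a := by
  rw [biasedMean, div_eq_iff (card_mul_card_pos k ht).ne', Finset.sum_comm]
  simp only [← Finset.mul_sum, sum_biasWeight]
  rw [Finset.sum_const, nsmul_eq_mul, Finset.card_univ]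
  ring

theorem biasedMean_mono (h : ∀ x V, P x V ≤ Q x V) {p : ℝ}
    (hp : p ∈ Set.Icc (0 : ℝ) 1) : biasedMean P p ≤ biasedMean Q p := by
  refine div_le_div_of_nonneg_right ?_ (by positivity)
  exact Finset.sum_le_sum fun x _ => Finset.sum_le_sum fun V _ =>
    mul_le_mul_of_nonneg_right (h x V) (biasWeight_nonneg hp x V)

theorem biasedMean_eq_sum (p : ℝ) :
    biasedMean P p = ∑ S : Finset (Fin k), blockCoeff P S * (1 - 2 * p) ^ S.card := by
  simp only [biasedMean, blockCoeff, biasWeight_eq_sum, Finset.mul_sum]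
  simp only [div_mul_eq_mul_div, ← Finset.sum_div]
  congr 1
  calc _ = ∑ x, ∑ S : Finset (Fin k), ∑ V, P x V * ((1 - 2 * p) ^ S.card * blockChar S x V) :=
        Finset.sum_congr rfl fun x _ => Finset.sum_comm
    _ = ∑ S : Finset (Fin k), ∑ x, ∑ V, P x V * ((1 - 2 * p) ^ S.card * blockChar S x V) :=
        Finset.sum_comm
    _ = _ := by
        refine Finset.sum_congr rfl fun S _ => ?_
        rw [Finset.sum_mul]
        refine Finset.sum_congr rfl fun x _ => ?_
        rw [Finset.sum_mul]
        exact Finset.sum_congr rfl fun V _ => by ring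

theorem le_biasedMean_zero (ht : 0 < t) {a : ℝ}
    (h : ∀ x V, (∀ j, x j (V j) = false) → a ≤ P x V) : a ≤ biasedMean P 0 := by
  rw [← biasedMean_const (k := k) ht a 0]
  refine div_le_div_of_nonneg_right ?_ (by positivity)
  refine Finset.sum_le_sum fun x _ => Finset.sum_le_sum fun V _ => ?_
  by_cases hx : ∀ j, x j (V j) = false
  · exact mul_le_mul_of_nonneg_right (h x V hx) (biasWeight_nonneg (by simp) x V)
  · push Not at hx
    obtain ⟨j, hj⟩ := hx
    rw [biasWeight_zero_of_eq_true (by simpa using hj), mul_zero, mul_zero]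

/-- Intersecting pairs contribute at most `a`; disjoint ones have mass `(1 - p) ^ k` under bias `p`.
-/
theorem biasedMean_le (ht : 0 < t) {a : ℝ} (ha : 0 ≤ a) (h1 : ∀ x V, P x V ≤ 1)
    (h : ∀ x V j, x j (V j) = true → P x V ≤ a) {p : ℝ} (hp : p ∈ Set.Icc (0 : ℝ) 1) :
    biasedMean P p ≤ a + (1 - p) ^ k := by
  have key : ∀ (x : Fin k → Fin t → Bool) (V : Fin k → Fin t),
      P x V * biasWeight p x V ≤ a * biasWeight p x V + (1 - p) ^ k * biasWeight 0 x V := by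
    intro x V
    have hw := biasWeight_nonneg hp x V
    have hp1 : 0 ≤ (1 - p) ^ k := pow_nonneg (by linarith [hp.2]) _
    by_cases hx : ∀ j, x j (V j) = false
    · rw [← biasWeight_of_forall_eq_false p hx]
      have := mul_le_mul_of_nonneg_right (h1 x V) hw
      have := mul_nonneg ha hw
      linarith
    · push Not at hx
      obtain ⟨j, hj⟩ := hx
      have := mul_le_mul_of_nonneg_right (h x V j (by simpa using hj)) hw
      have := mul_nonneg hp1 (biasWeight_nonneg (p := 0) (by simp) x V)
      linarith
  have e : a + (1 - p) ^ k =
      biasedMean (fun (_ : Fin k → Fin t → Bool) (_ : Fin k → Fin t) => a) p +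
      biasedMean (fun (_ : Fin k → Fin t → Bool) (_ : Fin k → Fin t) => (1 - p) ^ k) 0 := by
    rw [biasedMean_const ht, biasedMean_const ht]
  rw [e, biasedMean, biasedMean, biasedMean, ← add_div]
  refine div_le_div_of_nonneg_right ?_ (by positivity)
  simp only [← Finset.sum_add_distrib]
  exact Finset.sum_le_sum fun x _ => Finset.sum_le_sum fun V _ => key x V

open Polynomial in
/-- The part of degree less than `d` of the expansion of `biasedMean P`. -/
noncomputable def lowPart (P : (Fin k → Fin t → Bool) → (Fin k → Fin t) → ℝ) (d : ℕ) : ℝ[X] :=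
  ∑ S : Finset (Fin k) with S.card < d, C (blockCoeff P S) * (1 - 2 * X) ^ S.card

open Polynomial in
theorem degree_lowPart_lt (d : ℕ) : (lowPart P d).degree < d := by
  refine (degree_sum_le _ _).trans_lt ((Finset.sup_lt_iff (WithBot.bot_lt_coe d)).2 fun S hS => ?_)
  have hS : S.card < d := by simpa using hS
  have h1 : (1 - 2 * X : ℝ[X]).natDegree ≤ 1 := by compute_degree
  have h2 : (C (blockCoeff P S) * (1 - 2 * X : ℝ[X]) ^ S.card).natDegree ≤ S.card := by
    refine (natDegree_C_mul_le _ _).trans (natDegree_pow_le.trans ?_)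
    nlinarith
  exact (natDegree_le_iff_degree_le.1 h2).trans_lt (Nat.cast_lt.2 hS)

theorem abs_biasedMean_sub_lowPart_le {d : ℕ} {η : ℝ} (hη : 0 ≤ η)
    (h : ∀ S, d ≤ S.card → |blockCoeff P S| ≤ η) {p : ℝ}
    (hp : p ∈ Set.Icc (0 : ℝ) 1) : |biasedMean P p - (lowPart P d).eval p| ≤ 2 ^ k * η := by
  have e : (lowPart P d).eval p =
      ∑ S : Finset (Fin k) with S.card < d, blockCoeff P S * (1 - 2 * p) ^ S.card := by
    simp [lowPart, Polynomial.eval_finsetSum]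
  rw [biasedMean_eq_sum, e, ← Finset.sum_filter_add_sum_filter_not Finset.univ
    (fun S : Finset (Fin k) => S.card < d), add_sub_cancel_left]
  refine (Finset.abs_sum_le_sum_abs _ _).trans ?_
  have hp' : |1 - 2 * p| ≤ 1 := abs_le.2 ⟨by linarith [hp.2], by linarith [hp.1]⟩
  calc _ ≤ ∑ S : Finset (Fin k) with ¬ S.card < d, η := by
        refine Finset.sum_le_sum fun S hS => ?_
        have hS : d ≤ S.card := by simpa using hS
        rw [abs_mul, abs_pow]
        exact (mul_le_of_le_one_right (abs_nonneg _) (pow_le_one₀ (abs_nonneg _) hp')).trans (h S hS)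
    _ ≤ ∑ S : Finset (Fin k), η :=
        Finset.sum_le_sum_of_subset_of_nonneg (Finset.filter_subset _ _) fun _ _ _ => hη
    _ = _ := by simp

end

/-- For a suitable number of blocks of a suitable size, a function with small correlations with
the characters of high degree does not tell disjoint pairs from intersecting ones. -/
theorem exists_blocks_no_approximation (c : ℕ) {ε : ℝ} (hε : 0 < ε) :
    ∃ k t : ℕ, 0 < t ∧ ∀ P : (Fin k → Fin t → Bool) → (Fin k → Fin t) → ℝ,
      (∀ x V, 0 ≤ P x V) → (∀ x V, P x V ≤ 1) →
      (∀ x V, (∀ j, x j (V j) = false) → 1 / 2 + ε ≤ P x V) →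
      (∀ x V j, x j (V j) = true → P x V ≤ 1 / 2 - ε) →
      ∃ S : Finset (Fin k), (((3 ^ (c * Nat.log 2 (2 * (k * t + 1))) : ℕ) : ℝ) ^ 2 *
        ((Fintype.card (Fin k → Fin t → Bool) : ℝ) * Fintype.card (Fin k → Fin t) /
          √((t : ℝ) ^ S.card))) < |∑ x, ∑ V, P x V * blockChar S x V| := by
  -- At `|S| ≥ 8 * c + 2` the factor `t ^ (-|S| / 2) ≤ t ^ (-4 * c - 1)` beats the `K * t ^ (4 * c)`
  -- message pairs by a factor `t`.
  obtain ⟨C, hC, hCQ⟩ := exists_lipschitz_const_of_degree_lt (8 * c + 2)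
  set p : ℝ := min 1 (ε / (2 * C)) with hp
  have hp0 : 0 < p := lt_min one_pos (by positivity)
  have hp1 : p ≤ 1 := min_le_left _ _
  have hpI : p ∈ Set.Icc (0 : ℝ) 1 := ⟨hp0.le, hp1⟩
  have hCp : C * p ≤ ε / 2 := by
    calc C * p ≤ C * (ε / (2 * C)) := mul_le_mul_of_nonneg_left (min_le_right _ _) hC.le
      _ = ε / 2 := by field_simp
  obtain ⟨k, hk⟩ := exists_pow_lt_of_lt_one (show 0 < ε / 2 by positivity)
    (show 1 - p < 1 by linarith)
  set K : ℝ := (2 * ((k : ℝ) + 1)) ^ (4 * c) with hK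
  -- Makes the `2 ^ k` possible high-degree terms, each at most `K / t`, add up to at most `ε / 4`.
  obtain ⟨t, ht⟩ := exists_nat_gt (4 * 2 ^ k * K / ε)
  have ht0' : (0 : ℝ) < t := lt_of_le_of_lt (by positivity) ht
  have ht0 : 0 < t := by exact_mod_cast ht0'
  have ht1 : (1 : ℝ) ≤ t := by exact_mod_cast ht0
  refine ⟨k, t, ht0, fun P hP0 hP1 hdisj hint => ?_⟩
  by_contra! hS
  -- Forced by any disjoint pair; it gives `0 ≤ 1 / 2 - ε` and keeps the approximating polynomial
  -- within `[-2, 2]`.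
  have hε2 : ε ≤ 1 / 2 := by
    have h1 := hdisj (fun _ _ => false) (fun _ => ⟨0, ht0⟩) fun _ => rfl
    have h2 := hP1 (fun _ _ => false) (fun _ => ⟨0, ht0⟩)
    linarith
  have hZ := card_mul_card_pos k ht0
  have hcoeff : ∀ S : Finset (Fin k), 8 * c + 2 ≤ S.card → |blockCoeff P S| ≤ K / t := by
    intro S hcard
    rw [blockCoeff, abs_div, abs_of_pos hZ, div_le_iff₀ hZ]
    refine (hS S).trans ?_
    have h1 : (t : ℝ) ^ (4 * c + 1) ≤ √((t : ℝ) ^ S.card) := by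
      refine Real.le_sqrt_of_sq_le ?_
      rw [← pow_mul]
      exact pow_le_pow_right₀ ht1 (by omega)
    have h2 : ((3 ^ (c * Nat.log 2 (2 * (k * t + 1))) : ℕ) : ℝ) ^ 2 ≤ K * (t : ℝ) ^ (4 * c) := by
      have := three_pow_log_sq_le c k t ht0
      rw [hK]
      exact_mod_cast this
    calc _ ≤ K * (t : ℝ) ^ (4 * c) * ((Fintype.card (Fin k → Fin t → Bool) : ℝ) *
          Fintype.card (Fin k → Fin t) / (t : ℝ) ^ (4 * c + 1)) := by gcongr
      _ = _ := by
          rw [pow_succ]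
          field_simp
  have hKt : 2 ^ k * (K / t) ≤ ε / 4 := by
    rw [div_lt_iff₀ hε] at ht
    rw [← mul_div_assoc, div_le_iff₀ ht0']
    linarith
  have happ : ∀ q ∈ Set.Icc (0 : ℝ) 1,
      |biasedMean P q - (lowPart P (8 * c + 2)).eval q| ≤ ε / 4 := fun q hq =>
    (abs_biasedMean_sub_lowPart_le (by positivity) hcoeff hq).trans hKt
  have hG : ∀ q ∈ Set.Icc (0 : ℝ) 1, 0 ≤ biasedMean P q ∧ biasedMean P q ≤ 1 := fun q hq =>
    ⟨(biasedMean_const ht0 0 q).symm.le.trans (biasedMean_mono hP0 hq),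
      (biasedMean_mono hP1 hq).trans (biasedMean_const ht0 1 q).le⟩
  have h0 : (0 : ℝ) ∈ Set.Icc (0 : ℝ) 1 := by simp
  have hlip := hCQ _ (degree_lowPart_lt (P := P) (8 * c + 2)) (fun q hq => by
    have h1 := abs_le.1 (happ q hq)
    have h2 := hG q hq
    exact abs_le.2 ⟨by linarith, by linarith⟩) p hpI
  -- The mean drops by more than `2 * ε - ε / 2` between `0` and `p`, whereas the Lipschitz bound
  -- and the two approximation errors allow only `ε / 2 + ε / 4 + ε / 4`.
  have hlow := le_biasedMean_zero ht0 hdisj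
  have hup := biasedMean_le ht0 (by linarith) hP1 hint hpI
  have a1 := abs_le.1 (happ 0 h0)
  have a2 := abs_le.1 (happ p hpI)
  have a3 := abs_le.1 hlip
  linarith

/-! ### The instances of the language -/

/-- Two joined stars whose leaves hold the vectors `x` and `y`. -/
def starInstance {m : ℕ} (x y : Fin m → Bool) : LabeledGraph where
  V := StarNode m
  finite := inferInstance
  nonempty := inferInstance
  G := joinedStars m
  label := starLabel x y

/-- Distinct identifiers for the nodes of two joined stars. -/
noncomputable def starIdent (m : ℕ) (v : StarNode m) : ℕ := (Fintype.equivFin (StarNode m) v : ℕ) + 1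

theorem card_starNode (m : ℕ) : Nat.card (StarNode m) = 2 * (m + 1) := by
  simp [Nat.card_eq_fintype_card]

theorem isIdAssignment_starIdent {N : ℕ → ℕ} (hN : ∀ n, n ≤ N n) {m : ℕ} (x y : Fin m → Bool) :
    IsIdAssignment N (starInstance x y) (starIdent m) := by
  refine ⟨fun u v h => ?_, fun v => ⟨Nat.le_add_left 1 _, ?_⟩⟩
  · exact (Fintype.equivFin (StarNode m)).injective (Fin.ext (Nat.succ_injective h))
  · refine le_trans ?_ (hN _)
    change _ ≤ Nat.card (StarNode m)
    rw [Nat.card_eq_fintype_card]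
    exact (Fintype.equivFin (StarNode m) v).2

theorem bits_injective : Function.Injective Nat.bits := by
  intro a b h
  rw [← Nat.digits_inj_iff (b := 2), Nat.digits_two_eq_bits, Nat.digits_two_eq_bits, h]

theorem leafLabel_inj {b b' : Bool} {i i' : ℕ} (h : leafLabel b i = leafLabel b' i') :
    b = b' ∧ i = i' := by
  simp only [leafLabel, List.cons.injEq] at h
  exact ⟨h.1, bits_injective h.2⟩

/-- An isomorphism might exchange the stars, but labels determine indices: two distinct leaves with
the same index lie in opposite stars, so a common `1` stays a common `1`. -/
theorem starInstance_mem_iff {m : ℕ} (x y : Fin m → Bool) :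
    starInstance x y ∈ disjEdgeStar ↔ ∀ i, ¬ (x i = true ∧ y i = true) := by
  refine ⟨?_, fun h => ⟨m, x, y, SimpleGraph.Iso.refl, fun v => rfl, h⟩⟩
  rintro ⟨n, x', y', φ, hφ, hdisj⟩ i ⟨hx, hy⟩
  let u : (starInstance x y).V := ((false, some i) : StarNode m)
  let v : (starInstance x y).V := ((true, some i) : StarNode m)
  have h1 : starLabel x' y' (φ u) = leafLabel true (i + 1) :=
    (hφ u).symm.trans (congrArg (fun b => leafLabel b (i + 1)) hx)
  have h2 : starLabel x' y' (φ v) = leafLabel true (i + 1) :=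
    (hφ v).symm.trans (congrArg (fun b => leafLabel b (i + 1)) hy)
  have hne : φ u ≠ φ v := fun h => by
    have h3 : ((false, some i) : StarNode m) = (true, some i) := φ.injective h
    simp at h3
  revert h1 h2 hne
  generalize φ u = u
  generalize φ v = v
  intro h1 h2 hne
  rcases u with ⟨_ | _, _ | j⟩ <;> rcases v with ⟨_ | _, _ | j'⟩ <;>
    simp only [starLabel] at h1 h2 <;> try simp only [leafLabel, List.nil_eq, reduceCtorEq] at h1 h2
  all_goals
    obtain ⟨h1, h1'⟩ := leafLabel_inj h1
    obtain ⟨h2, h2'⟩ := leafLabel_inj h2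
    have : j = j' := Fin.ext (by omega)
    subst this
    first
      | exact hne rfl
      | exact hdisj j ⟨h1, h2⟩
      | exact hdisj j ⟨h2, h1⟩

/-! ### Locality of two rounds on joined stars -/

section locality

variable (A : Algorithm) {m : ℕ} (ident : StarNode m → ℕ)

/-- The state after `r` rounds on two joined stars. -/
noncomputable def starState (x y : Fin m → Bool) (r : ℕ) (v : StarNode m) : A.State :=
  A.state (starInstance x y) ident r v

theorem starState_zero (x y : Fin m → Bool) (v : StarNode m) :
    starState A ident x y 0 v = A.init (Nat.card (StarNode m)) (ident v) (starLabel x y v)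
      {k | ∃ w, (joinedStars m).Adj v w ∧ k = ident w} := rfl

theorem starState_succ (x y : Fin m → Bool) (r : ℕ) (v : StarNode m) :
    starState A ident x y (r + 1) v = A.recv r (starState A ident x y r v)
      {q | ∃ w, (joinedStars m).Adj v w ∧
        q = (ident w, A.send r (starState A ident x y r w) (ident v))} := rfl

/-- The message that the center of the star `s` sends to the other center at the second round. -/
noncomputable def centerMessage (x y : Fin m → Bool) (s : Bool) : List Bool :=
  A.send 1 (starState A ident x y 1 (s, none)) (ident (!s, none))

theorem starState_succ_congr {x y x' y' : Fin m → Bool} {r : ℕ} {v : StarNode m}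
    (hv : starState A ident x y r v = starState A ident x' y' r v)
    (h : ∀ w, (joinedStars m).Adj v w → A.send r (starState A ident x y r w) (ident v) =
      A.send r (starState A ident x' y' r w) (ident v)) :
    starState A ident x y (r + 1) v = starState A ident x' y' (r + 1) v := by
  rw [starState_succ, starState_succ, hv]
  congr 1
  ext q
  refine exists_congr fun w => and_congr_right fun hw => ?_
  rw [h w hw]

/-- `(x, y)` and `(x', y')` assign the same labels to the star `s`. -/
def SameSide (s : Bool) (x y x' y' : Fin m → Bool) : Prop :=
  ∀ v : StarNode m, v.1 = s → starLabel x y v = starLabel x' y' v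

variable {A ident} {s : Bool} {x y x' y' : Fin m → Bool}

/-- The only node of the other star heard in the first round is its center, whose initial state
involves no input bit. -/
theorem starState_one_congr (h : SameSide s x y x' y') {v : StarNode m} (hv : v.1 = s) :
    starState A ident x y 1 v = starState A ident x' y' 1 v := by
  have h0 : ∀ w : StarNode m, w.1 = s ∨ w.2 = none →
      starState A ident x y 0 w = starState A ident x' y' 0 w := by
    intro w hw
    have : starLabel x y w = starLabel x' y' w := by
      rcases hw with hw | hw
      · exact h w hw
      · obtain ⟨b, i⟩ := w
        subst hw
        cases b <;> rfl
    rw [starState_zero, starState_zero, this]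
  refine starState_succ_congr A ident (h0 v (Or.inl hv)) fun w hw => ?_
  rw [h0 w]
  rcases hw with hw | hw
  · exact Or.inr hw.2.2
  · exact Or.inl (hw.1.symm.trans hv)

theorem centerMessage_congr (h : SameSide s x y x' y') :
    centerMessage A ident x y s = centerMessage A ident x' y' s := by
  rw [centerMessage, centerMessage, starState_one_congr h rfl]

theorem starState_two_congr (h : SameSide s x y x' y')
    (hm : centerMessage A ident x y (!s) = centerMessage A ident x' y' (!s))
    {v : StarNode m} (hv : v.1 = s) :
    starState A ident x y 2 v = starState A ident x' y' 2 v := by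
  refine starState_succ_congr A ident (starState_one_congr h hv) fun w hw => ?_
  rcases hw with hw | hw
  · obtain ⟨a, i⟩ := v
    obtain ⟨b, j⟩ := w
    obtain ⟨h1, h2, h3⟩ := hw
    simp only at h1 h2 h3 hv
    subst h2 h3 hv
    obtain rfl : b = !a := by cases a <;> cases b <;> simp_all
    simpa [centerMessage] using hm
  · rw [starState_one_congr h (hw.1.symm.trans hv)]

theorem sameSide_false (x y y' : Fin m → Bool) : SameSide false x y x y' := by
  rintro ⟨a, _ | i⟩ h
  · cases a <;> rfl
  · simp only at h
    subst h
    rfl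

theorem sameSide_true (x x' y : Fin m → Bool) : SameSide true x y x' y := by
  rintro ⟨a, _ | i⟩ h
  · cases a <;> rfl
  · simp only at h
    subst h
    rfl

variable (A ident)

/-- All the nodes of the star `s` accept. -/
def SideAccepts (s : Bool) (x y : Fin m → Bool) : Prop :=
  ∀ v : StarNode m, v.1 = s → A.accept (starState A ident x y 2 v)

variable {A ident}

theorem sideAccepts_congr (h : SameSide s x y x' y')
    (hm : centerMessage A ident x y (!s) = centerMessage A ident x' y' (!s)) :
    SideAccepts A ident s x y ↔ SideAccepts A ident s x' y' :=
  forall_congr' fun _ => imp_congr_right fun hv => by rw [starState_two_congr h hm hv]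

theorem allAccept_starInstance :
    A.AllAccept 2 (starInstance x y) ident ↔
      SideAccepts A ident false x y ∧ SideAccepts A ident true x y := by
  refine ⟨fun h => ⟨fun v _ => h v, fun v _ => h v⟩, fun h v => ?_⟩
  obtain ⟨_ | _, i⟩ := v
  · exact h.1 (false, i) rfl
  · exact h.2 (true, i) rfl

variable (A ident)

/-- On joined stars, two rounds amount to the exchange of one message between the two centers,
after which each star decides. -/
theorem exists_protocol : ∃ f g : (Fin m → Bool) → List Bool → Prop, ∀ x y,
    A.AllAccept 2 (starInstance x y) ident ↔
      f x (centerMessage A ident (fun _ => false) y true) ∧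
      g y (centerMessage A ident x (fun _ => false) false) := by
  -- A side's verdict depends only on its own vector and the received message, so any opposite
  -- vector producing that message may stand in for the true one. Likewise the all-`false` vectors
  -- in the statement are placeholders that do not affect the messages.
  refine ⟨fun x β => ∃ y, centerMessage A ident x y true = β ∧ SideAccepts A ident false x y,
    fun y α => ∃ x, centerMessage A ident x y false = α ∧ SideAccepts A ident true x y,
    fun x y => allAccept_starInstance.trans (and_congr ?_ ?_)⟩
  · refine ⟨fun h => ⟨y, centerMessage_congr (sameSide_true _ _ _), h⟩, ?_⟩
    rintro ⟨y', h1, h2⟩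
    refine (sideAccepts_congr (sameSide_false x y y') ?_).2 h2
    exact (centerMessage_congr (sameSide_true _ _ _)).trans h1.symm
  · refine ⟨fun h => ⟨x, centerMessage_congr (sameSide_false _ _ _), h⟩, ?_⟩
    rintro ⟨x', h1, h2⟩
    refine (sideAccepts_congr (sameSide_true x x' y) ?_).2 h2
    exact (centerMessage_congr (sameSide_false _ _ _)).trans h1.symm

theorem length_centerMessage_le {N : ℕ → ℕ} (hN : ∀ n, n ≤ N n) {c : ℕ}
    (hA : A.FitsSchedule N [RoundKind.LOCAL, RoundKind.CONGEST] c) (x y : Fin m → Bool) (s : Bool) :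
    (centerMessage A (starIdent m) x y s).length ≤ c * Nat.log 2 (2 * (m + 1)) := by
  rw [← card_starNode]
  refine hA (starInstance x y) (starIdent m) (isIdAssignment_starIdent hN x y) 1 rfl
    (s, none) (!s, none) (Or.inl ⟨?_, rfl, rfl⟩)
  cases s <;> simp

end locality

/-! ### The lower bound -/

/-- Bit strings of length at most `L`, padded. -/
def padBits (L : ℕ) (l : List Bool) : Fin L → Option Bool := fun i => l[(i : ℕ)]?

theorem padBits_injOn (L : ℕ) : Set.InjOn (padBits L) {l | l.length ≤ L} := by
  intro l hl l' hl' h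
  refine List.ext_getElem? fun i => ?_
  by_cases hi : i < L
  · exact congrFun h ⟨i, hi⟩
  · have h1 : l.length ≤ L := hl
    have h2 : l'.length ≤ L := hl'
    rw [List.getElem?_eq_none (by omega), List.getElem?_eq_none (by omega)]

/-- The vector with the bits of all blocks. -/
def flatBits {k t : ℕ} (x : Fin k → Fin t → Bool) (i : Fin (k * t)) : Bool :=
  x (finProdFinEquiv.symm i).1 (finProdFinEquiv.symm i).2

/-- The vector with exactly one bit `1` in each block, at the position given by `V`. -/
def selectBits {k t : ℕ} (V : Fin k → Fin t) (i : Fin (k * t)) : Bool :=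
  decide (V (finProdFinEquiv.symm i).1 = (finProdFinEquiv.symm i).2)

theorem flatBits_selectBits_disjoint_iff {k t : ℕ} (x : Fin k → Fin t → Bool) (V : Fin k → Fin t) :
    (∀ i, ¬ (flatBits x i = true ∧ selectBits V i = true)) ↔ ∀ j, x j (V j) = false := by
  rw [← finProdFinEquiv.forall_congr_right]
  simp only [flatBits, selectBits, Equiv.symm_apply_apply, Prod.forall, decide_eq_true_eq]
  refine ⟨fun h j => ?_, fun h j i hi => ?_⟩
  · simpa using h j (V j)
  · have := h j
    rw [hi.2, hi.1] at this
    exact Bool.noConfusion this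

open Classical in
theorem abs_sum_allAccept_le (A : Algorithm) {N : ℕ → ℕ} (hN : ∀ n, n ≤ N n) {c : ℕ}
    (hA : A.FitsSchedule N [RoundKind.LOCAL, RoundKind.CONGEST] c) {k t : ℕ} (ht : 0 < t)
    (S : Finset (Fin k)) :
    |∑ x : Fin k → Fin t → Bool, ∑ V, (if A.AllAccept 2
      (starInstance (flatBits x) (selectBits V)) (starIdent (k * t)) then (1 : ℝ) else 0) *
        blockChar S x V| ≤ ((3 ^ (c * Nat.log 2 (2 * (k * t + 1))) : ℕ) : ℝ) ^ 2 *
        ((Fintype.card (Fin k → Fin t → Bool) : ℝ) * Fintype.card (Fin k → Fin t) /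
          √((t : ℝ) ^ S.card)) := by
  obtain ⟨f, g, hfg⟩ := exists_protocol A (starIdent (k * t))
  set L := c * Nat.log 2 (2 * (k * t + 1)) with hL
  let a : (Fin k → Fin t → Bool) → List Bool := fun x =>
    centerMessage A (starIdent (k * t)) (flatBits x) (fun _ => false) false
  let b : (Fin k → Fin t) → List Bool := fun V =>
    centerMessage A (starIdent (k * t)) (fun _ => false) (selectBits V) true
  have ha : ∀ x, (a x).length ≤ L := fun x => length_centerMessage_le A hN hA _ _ _
  have hb : ∀ V, (b V).length ≤ L := fun V => length_centerMessage_le A hN hA _ _ _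
  have key : ∀ x V, A.AllAccept 2 (starInstance (flatBits x) (selectBits V))
      (starIdent (k * t)) ↔
      (∃ β : List Bool, β.length ≤ L ∧ padBits L β = padBits L (b V) ∧ f (flatBits x) β) ∧
      (∃ α : List Bool, α.length ≤ L ∧ padBits L α = padBits L (a x) ∧ g (selectBits V) α) := by
    intro x V
    rw [hfg]
    refine and_congr ⟨fun h => ⟨_, hb V, rfl, h⟩, ?_⟩ ⟨fun h => ⟨_, ha x, rfl, h⟩, ?_⟩
    · rintro ⟨β, h1, h2, h3⟩
      rwa [padBits_injOn L h1 (hb V) h2] at h3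
    · rintro ⟨α, h1, h2, h3⟩
      rwa [padBits_injOn L h1 (ha x) h2] at h3
  -- Padding turns messages of at most `L` bits into a finite type with `3 ^ L` elements; the length
  -- bounds inside the predicates make decoding unique.
  have h := abs_sum_protocol_le ht S (fun x => padBits L (a x)) (fun V => padBits L (b V))
    (fun x m => ∃ β : List Bool, β.length ≤ L ∧ padBits L β = m ∧ f (flatBits x) β)
    (fun V m => ∃ α : List Bool, α.length ≤ L ∧ padBits L α = m ∧ g (selectBits V) α)
  have hcard : Fintype.card (Fin L → Option Bool) = 3 ^ L := by simp
  rw [hcard] at h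
  simpa only [key] using h

theorem disjEdgeStar_notMem_randLC {N : ℕ → ℕ} (hN : ∀ n, n ≤ N n) {ε : ℝ} (hε : 0 < ε) :
    disjEdgeStar ∉ RandLC N (1 / 2 - ε) := by
  classical
  rintro ⟨Ω, _, μ, _, A, c, hA, hdec⟩
  obtain ⟨k, t, ht, hkt⟩ := exists_blocks_no_approximation c hε
  let E : (Fin k → Fin t → Bool) → (Fin k → Fin t) → Set Ω := fun x V =>
    {ω | (A ω).AllAccept 2 (starInstance (flatBits x) (selectBits V)) (starIdent (k * t))}
  have hE : ∀ x V, MeasurableSet (E x V) ∧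
      ((∀ j, x j (V j) = false) → 1 - (1 / 2 - ε) ≤ μ.real (E x V)) ∧
      (¬ (∀ j, x j (V j) = false) → 1 - (1 / 2 - ε) ≤ μ.real (E x V)ᶜ) := by
    intro x V
    have h := hdec _ _ (isIdAssignment_starIdent hN (flatBits x) (selectBits V))
    rw [starInstance_mem_iff, flatBits_selectBits_disjoint_iff] at h
    exact h
  obtain ⟨S, hS⟩ := hkt (fun x V => μ.real (E x V)) (fun _ _ => measureReal_nonneg)
    (fun _ _ => measureReal_le_one) (fun x V h => by linarith [(hE x V).2.1 h])
    (fun x V j h => by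
      have h1 := (hE x V).2.2 fun h' => by simp [h' j] at h
      rw [probReal_compl_eq_one_sub (hE x V).1] at h1
      linarith)
  refine absurd hS (not_lt.2 ?_)
  have hint : ∀ x V, Integrable (fun ω => (E x V).indicator (fun _ => (1 : ℝ)) ω *
      blockChar S x V) μ := fun x V =>
    ((integrable_const 1).indicator (hE x V).1).mul_const _
  -- The correlation of the acceptance probability is the mean over the coins of the deterministic
  -- correlations, each of which obeys the same bound.
  have e : ∑ x, ∑ V, μ.real (E x V) * blockChar S x V =
      ∫ ω, ∑ x, ∑ V, (E x V).indicator (fun _ => (1 : ℝ)) ω * blockChar S x V ∂μ := by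
    rw [integral_finsetSum _ fun x _ => integrable_finsetSum _ fun V _ => hint x V]
    refine Finset.sum_congr rfl fun x _ => ?_
    rw [integral_finsetSum _ fun V _ => hint x V]
    refine Finset.sum_congr rfl fun V _ => ?_
    rw [integral_mul_const, integral_indicator_const _ (hE x V).1]
    simp
  rw [e, ← Real.norm_eq_abs]
  refine (norm_integral_le_of_norm_le_const (C := ((3 ^ (c * Nat.log 2 (2 * (k * t + 1))) : ℕ) : ℝ)
    ^ 2 * ((Fintype.card (Fin k → Fin t → Bool) : ℝ) * Fintype.card (Fin k → Fin t) /
      √((t : ℝ) ^ S.card))) (Filter.Eventually.of_forall fun ω => ?_)).trans (by simp)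
  rw [Real.norm_eq_abs]
  simpa only [Set.indicator_apply, E, Set.mem_ofPred_eq] using
    abs_sum_allAccept_le (A ω) hN (hA ω) ht S

theorem LC_subset_randLC (N : ℕ → ℕ) : LC N ⊆ RandLC N 0 := by
  rintro L ⟨A, c, hA, hdec⟩
  refine ⟨Unit, inferInstance, Measure.dirac (), inferInstance, fun _ => A, c, fun _ => hA,
    fun I ident hid => ⟨MeasurableSet.const _, fun h => ?_, fun h => ?_⟩⟩
  · have h1 : A.AllAccept 2 I ident := (hdec I ident hid).1 h
    have h2 : {ω : Unit | A.AllAccept 2 I ident} = Set.univ := Set.eq_univ_of_forall fun _ => h1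
    change 1 - 0 ≤ (Measure.dirac ()).real {ω : Unit | A.AllAccept 2 I ident}
    rw [h2, probReal_univ, sub_zero]
  · have h1 : ¬ A.AllAccept 2 I ident := mt (hdec I ident hid).2 h
    have h2 : {ω : Unit | ¬ A.AllAccept 2 I ident} = Set.univ := Set.eq_univ_of_forall fun _ => h1
    change 1 - 0 ≤ (Measure.dirac ()).real {ω : Unit | ¬ A.AllAccept 2 I ident}
    rw [h2, probReal_univ, sub_zero]

/-! ### Neighborhoods in joined stars -/

/-- The neighbors of the center of the star `s`. -/
def centerNbr {m : ℕ} (s : Bool) : Option (Fin m) → StarNode m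
  | none => (!s, none)
  | some i => (s, some i)

/-- The labels of the neighbors of the center of a star whose leaves hold the vector `x`. -/
def nbrLabel {m : ℕ} (x : Fin m → Bool) : Option (Fin m) → List Bool
  | none => []
  | some i => leafLabel (x i) (i + 1)

theorem centerNbr_injective {m : ℕ} (s : Bool) :
    Function.Injective (centerNbr s : Option (Fin m) → StarNode m) := by
  rintro (_ | i) (_ | j) h <;> simp_all [centerNbr]

theorem joinedStars_adj_center {m : ℕ} {s : Bool} {w : StarNode m} :
    (joinedStars m).Adj (s, none) w ↔ ∃ o, w = centerNbr s o := by
  constructor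
  · obtain ⟨b, _ | j⟩ := w
    · rintro (h | h)
      · refine ⟨none, ?_⟩
        cases s <;> cases b <;> simp_all [centerNbr]
      · simp at h
    · rintro (h | h)
      · simp at h
      · exact ⟨some j, by simpa [centerNbr] using h.1.symm⟩
  · rintro ⟨_ | j, rfl⟩
    · left
      cases s <;> simp [centerNbr]
    · right
      simp [centerNbr]

theorem joinedStars_adj_leaf {m : ℕ} {s : Bool} {i : Fin m} {w : StarNode m} :
    (joinedStars m).Adj (s, some i) w ↔ w = (s, none) := by
  obtain ⟨b, j⟩ := w
  simp only [joinedStars, reduceCtorEq, false_and, and_false, false_or, false_iff, not_not,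
    Prod.mk.injEq, ne_eq]
  exact and_congr_left fun _ => eq_comm

theorem starLabel_centerNbr {m : ℕ} (z : Bool → Fin m → Bool) (s : Bool) (o : Option (Fin m)) :
    starLabel (z false) (z true) (centerNbr s o) = nbrLabel (z s) o := by
  cases s <;> cases o <;> rfl

theorem starLabel_center {m : ℕ} (x y : Fin m → Bool) (s : Bool) :
    starLabel x y (s, none) = [] := by
  cases s <;> rfl

theorem starLabel_leaf {m : ℕ} (z : Bool → Fin m → Bool) (s : Bool) (i : Fin m) :
    starLabel (z false) (z true) (s, some i) = leafLabel (z s i) (i + 1) := by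
  cases s <;> rfl

theorem length_leafLabel_le {m : ℕ} (b : Bool) (i : Fin m) :
    (leafLabel b (i + 1)).length ≤ 3 * Nat.log 2 (2 * m + 2) := by
  have h1 : 2 * m + 2 < 2 ^ (Nat.log 2 (2 * m + 2) + 1) := Nat.lt_pow_succ_log_self (by norm_num) _
  have h2 : Nat.size (i + 1) ≤ Nat.log 2 (2 * m + 2) + 1 :=
    Nat.size_le.2 (by have := i.2; omega)
  have h3 : 0 < Nat.log 2 (2 * m + 2) := Nat.log_pos (by norm_num) (by omega)
  rw [leafLabel, List.length_cons, Nat.size_eq_bits_len]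
  omega

/-! ### A local characterization of the language -/

/-- The two centers and their leaves are `2 * m + 2` distinct nodes: labels separate centers from
leaves, and a leaf's only neighbor determines its star. By the size hypothesis no other node exists,
so connectedness need not be checked. -/
theorem mem_disjEdgeStar_of_local {I : LabeledGraph} {m : ℕ} (hcard : I.size = 2 * m + 2)
    (ctr : Bool → I.V) (nb : Bool → Option (Fin m) → I.V) (z : Bool → Fin m → Bool)
    (hctr : ∀ s, I.label (ctr s) = []) (hnone : ∀ s, nb s none = ctr (!s))
    (hinj : ∀ s, Function.Injective (nb s))
    (hadj : ∀ s w, I.G.Adj (ctr s) w ↔ ∃ o, w = nb s o)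
    (hlab : ∀ s o, I.label (nb s o) = nbrLabel (z s) o)
    (hleaf : ∀ v, I.label v ≠ [] → ∃ c, ∀ w, I.G.Adj v w ↔ w = c)
    (hdisj : ∀ i, ¬ (z false i = true ∧ z true i = true)) : I ∈ disjEdgeStar := by
  have := I.finite
  let ψ : StarNode m → I.V := fun u => match u with
    | (s, none) => ctr s
    | (s, some i) => nb s (some i)
  have hψ : ∀ s o, ψ (centerNbr s o) = nb s o := by
    rintro s (_ | i)
    · exact (hnone s).symm
    · rfl
  have hψlab : ∀ u, I.label (ψ u) = starLabel (z false) (z true) u := by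
    rintro ⟨s, _ | i⟩
    · rw [starLabel_center]
      exact hctr s
    · rw [starLabel_leaf]
      exact hlab s (some i)
  have hcc : ∀ s, ctr s ≠ ctr (!s) := fun s =>
    ((hadj s _).2 ⟨none, (hnone s).symm⟩).ne
  have hcinj : ∀ s s', ctr s = ctr s' → s = s' := by
    intro s s' h
    by_contra hne
    obtain rfl : s' = !s := by cases s <;> cases s' <;> simp_all
    exact hcc s h
  have hleafadj : ∀ s i w, I.G.Adj (nb s (some i)) w ↔ w = ctr s := by
    intro s i w
    obtain ⟨c, hc⟩ := hleaf (nb s (some i)) (by simp [hlab, nbrLabel, leafLabel])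
    have h1 := (hc _).1 ((hadj s _).2 ⟨some i, rfl⟩).symm
    rw [hc, h1]
  have hψinj : Function.Injective ψ := by
    rintro ⟨s, o⟩ ⟨s', o'⟩ h
    have hl := congrArg I.label h
    rw [hψlab, hψlab] at hl
    rcases o with _ | i <;> rcases o' with _ | i'
    · rw [hcinj s s' h]
    · rw [starLabel_center, starLabel_leaf, leafLabel] at hl
      simp at hl
    · rw [starLabel_center, starLabel_leaf, leafLabel] at hl
      simp at hl
    · have h' : nb s (some i) = nb s' (some i') := h
      have h1 := (hleafadj s i (ctr s)).2 rfl
      rw [h', hleafadj] at h1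
      obtain rfl := hcinj s s' h1
      rw [Option.some_injective _ (hinj s h')]
  have hbij : Function.Bijective ψ := by
    refine (Nat.bijective_iff_injective_and_card ψ).2 ⟨hψinj, ?_⟩
    rw [card_starNode]
    exact (by omega : 2 * (m + 1) = 2 * m + 2).trans hcard.symm
  have hψadj : ∀ u w, I.G.Adj (ψ u) (ψ w) ↔ (joinedStars m).Adj u w := by
    rintro ⟨s, _ | i⟩ w
    · rw [joinedStars_adj_center]
      refine (hadj s _).trans (exists_congr fun o => ?_)
      rw [← hψ, hψinj.eq_iff]
    · rw [joinedStars_adj_leaf]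
      exact (hleafadj s i _).trans (hψinj.eq_iff (b := (s, none)))
  let φ : joinedStars m ≃g I.G := ⟨Equiv.ofBijective ψ hbij, fun {u w} => hψadj u w⟩
  refine ⟨m, z false, z true, φ.symm, fun v => ?_, hdisj⟩
  rw [← hψlab]
  exact congrArg I.label (φ.apply_symm_apply v).symm

/-! ### The algorithm -/

open Classical in
/-- The vector held by the leaves of a star, read off the set `M` of the labels received by
its center. -/
noncomputable def heardBits (M : Set (ℕ × List Bool)) (m : ℕ) (i : Fin m) : Bool :=
  decide (∃ k, (k, leafLabel true (i + 1)) ∈ M)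

open Classical in
theorem heardBits_range {m : ℕ} (κ : Option (Fin m) → ℕ) (x : Fin m → Bool) :
    heardBits (Set.range fun o => (κ o, nbrLabel x o)) m = x := by
  funext i
  rw [heardBits, Bool.eq_iff_iff, decide_eq_true_iff]
  constructor
  · rintro ⟨k, _ | j, h⟩
    · simp [nbrLabel, leafLabel] at h
    · obtain ⟨h1, h2⟩ := leafLabel_inj (Prod.ext_iff.1 h).2
      obtain rfl : j = i := Fin.ext (by omega)
      exact h1
  · intro h
    exact ⟨κ (some i), some i, by simp [nbrLabel, h]⟩

/-- What a node remembers: the size of the network, its label, and the messages received at the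
two rounds. -/
structure EdgeStarState where
  size : ℕ
  label : List Bool
  first : Set (ℕ × List Bool)
  second : Set (ℕ × List Bool)

/-- The acceptance condition of a center, for stars with `m` leaves. -/
def EdgeStarState.CenterAccepts (q : EdgeStarState) (m : ℕ) : Prop :=
  -- `κ` lists the neighbors' identifiers: one leaf per index and, at `none`, the opposite center.
  -- It thereby singles out the second-round message to compare with.
  q.label = [] ∧ ∃ κ : Option (Fin m) → ℕ, Function.Injective κ ∧
    q.first = Set.range (fun o => (κ o, nbrLabel (heardBits q.first m) o)) ∧
    ∃ y : Fin m → Bool, (κ none, List.ofFn y) ∈ q.second ∧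
      ∀ i, ¬ (heardBits q.first m i = true ∧ y i = true)

/-- The acceptance condition of a leaf, for stars with `m` leaves. -/
def EdgeStarState.LeafAccepts (q : EdgeStarState) (m : ℕ) : Prop :=
  (∃ b, ∃ i : Fin m, q.label = leafLabel b (i + 1)) ∧ ∃ k, q.first = {(k, [])}

/-- Every node sends its label to its neighbors, then the vector that it can read off the labels
received. -/
noncomputable def edgeStarAlgorithm : Algorithm where
  State := EdgeStarState
  init n _ l _ := ⟨n, l, ∅, ∅⟩
  send
    -- Truncation keeps the bandwidth bound on arbitrary instances. It loses nothing when all nodes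
    -- accept, since each node checks its own full label, which must then be short.
    | 0, q, _ => q.label.take (3 * Nat.log 2 q.size)
    | _ + 1, q, _ => List.ofFn (heardBits q.first (q.size / 2 - 1))
  recv
    | 0, q, M => { q with first := M }
    | _ + 1, q, M => { q with second := M }
  accept q := ∃ m, q.size = 2 * m + 2 ∧ (q.CenterAccepts m ∨ q.LeafAccepts m)

section

variable (I : LabeledGraph) (ident : I.V → ℕ)

/-- The labels of the neighbors, truncated. -/
def heardLabels (v : I.V) : Set (ℕ × List Bool) :=
  {q | ∃ w, I.G.Adj v w ∧ q = (ident w, (I.label w).take (3 * Nat.log 2 I.size))}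

/-- The messages of the second round. -/
noncomputable def heardVectors (v : I.V) : Set (ℕ × List Bool) :=
  {q | ∃ w, I.G.Adj v w ∧
    q = (ident w, List.ofFn (heardBits (heardLabels I ident w) (I.size / 2 - 1)))}

theorem edgeStarAlgorithm_state_two (v : I.V) :
    edgeStarAlgorithm.state I ident 2 v =
      (⟨I.size, I.label v, heardLabels I ident v, heardVectors I ident v⟩ : EdgeStarState) := rfl

theorem heardLabels_eq (h : ∀ w, (I.label w).length ≤ 3 * Nat.log 2 I.size) (v : I.V) :
    heardLabels I ident v = {q | ∃ w, I.G.Adj v w ∧ q = (ident w, I.label w)} := by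
  simp only [heardLabels, List.take_of_length_le (h _)]

theorem edgeStarAlgorithm_fitsSchedule (N : ℕ → ℕ) :
    edgeStarAlgorithm.FitsSchedule N [RoundKind.CONGEST, RoundKind.LOCAL] 3 := by
  rintro I ident - (_ | _ | t) ht v w -
  · exact List.length_take_le _ _
  · simp at ht
  · simp at ht

variable {I ident}

theorem edgeStarAlgorithm_allAccept_of_mem (hid : Function.Injective ident)
    (h : I ∈ disjEdgeStar) : edgeStarAlgorithm.AllAccept 2 I ident := by
  obtain ⟨m, x, y, φ, hlab, hdisj⟩ := h
  let z : Bool → Fin m → Bool := fun s => cond s y x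
  have hlab : ∀ v, I.label v = starLabel (z false) (z true) (φ v) := hlab
  have hsize : I.size = 2 * m + 2 := by
    rw [LabeledGraph.size, Nat.card_congr φ.toEquiv, card_starNode]
    ring
  have hshort : ∀ w, (I.label w).length ≤ 3 * Nat.log 2 I.size := by
    intro w
    rw [hlab, hsize]
    obtain ⟨s, _ | i⟩ := φ w
    · rw [starLabel_center]
      simp
    · rw [starLabel_leaf]
      exact length_leafLabel_le _ _
  have hheard : ∀ s, heardLabels I ident (φ.symm (s, none)) =
      Set.range fun o => (ident (φ.symm (centerNbr s o)), nbrLabel (z s) o) := by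
    intro s
    rw [heardLabels_eq I ident hshort]
    ext q
    constructor
    · rintro ⟨w, hw, rfl⟩
      rw [← φ.map_adj_iff, φ.apply_symm_apply, joinedStars_adj_center] at hw
      obtain ⟨o, ho⟩ := hw
      refine ⟨o, ?_⟩
      simp only [hlab w, ho, starLabel_centerNbr]
      rw [← ho, φ.symm_apply_apply]
    · rintro ⟨o, rfl⟩
      refine ⟨φ.symm (centerNbr s o), ?_, ?_⟩
      · rw [φ.symm.map_adj_iff, joinedStars_adj_center]
        exact ⟨o, rfl⟩
      · rw [hlab, φ.apply_symm_apply, starLabel_centerNbr]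
  have hm : I.size / 2 - 1 = m := by omega
  intro v
  rw [edgeStarAlgorithm_state_two]
  refine ⟨m, hsize, ?_⟩
  obtain ⟨u, rfl⟩ : ∃ u, v = φ.symm u := ⟨φ v, (φ.symm_apply_apply v).symm⟩
  obtain ⟨s, _ | i⟩ := u
  · left
    refine ⟨?_, fun o => ident (φ.symm (centerNbr s o)), ?_, ?_, z (!s), ?_, ?_⟩
    · simp only [hlab, φ.apply_symm_apply, starLabel_center]
    · exact hid.comp (φ.symm.injective.comp (centerNbr_injective s))
    · simp only [hheard, heardBits_range]
    · refine ⟨φ.symm (!s, none), ?_, ?_⟩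
      · rw [φ.symm.map_adj_iff, joinedStars_adj_center]
        exact ⟨none, rfl⟩
      · rw [hm, hheard, heardBits_range]
        rfl
    · intro i
      simp only [hheard, heardBits_range]
      cases s
      · exact hdisj i
      · exact fun h => hdisj i ⟨h.2, h.1⟩
  · right
    refine ⟨⟨z s i, i, ?_⟩, ident (φ.symm (s, none)), ?_⟩
    · simp only [hlab, φ.apply_symm_apply, starLabel_leaf]
    · simp only [heardLabels_eq I ident hshort]
      ext q
      constructor
      · rintro ⟨w, hw, rfl⟩
        rw [← φ.map_adj_iff, φ.apply_symm_apply, joinedStars_adj_leaf] at hw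
        rw [hlab w, hw, starLabel_center, ← hw, φ.symm_apply_apply]
        rfl
      · rintro rfl
        refine ⟨φ.symm (s, none), ?_, ?_⟩
        · rw [φ.symm.map_adj_iff, joinedStars_adj_leaf]
        · rw [hlab, φ.apply_symm_apply, starLabel_center]

theorem mem_of_edgeStarAlgorithm_allAccept (hid : Function.Injective ident)
    (h : edgeStarAlgorithm.AllAccept 2 I ident) : I ∈ disjEdgeStar := by
  have hacc : ∀ v, ∃ m, I.size = 2 * m + 2 ∧
      (EdgeStarState.CenterAccepts ⟨I.size, I.label v, heardLabels I ident v,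
        heardVectors I ident v⟩ m ∨
      EdgeStarState.LeafAccepts ⟨I.size, I.label v, heardLabels I ident v,
        heardVectors I ident v⟩ m) := h
  obtain ⟨v₀⟩ := I.nonempty
  obtain ⟨m, hsize, -⟩ := hacc v₀
  replace hacc : ∀ v, EdgeStarState.CenterAccepts ⟨I.size, I.label v, heardLabels I ident v,
        heardVectors I ident v⟩ m ∨
      EdgeStarState.LeafAccepts ⟨I.size, I.label v, heardLabels I ident v,
        heardVectors I ident v⟩ m := fun v => by
    obtain ⟨m', hm', h⟩ := hacc v
    obtain rfl : m' = m := by omega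
    exact h
  have hshort : ∀ w, (I.label w).length ≤ 3 * Nat.log 2 I.size := by
    intro w
    rcases hacc w with h | ⟨⟨b, i, h⟩, -⟩
    · simp [show I.label w = [] from h.1]
    · rw [show I.label w = leafLabel b (i + 1) from h, hsize]
      exact length_leafLabel_le b i
  have hheard := heardLabels_eq I ident hshort
  have hm : I.size / 2 - 1 = m := by omega
  have hleaf : ∀ v, I.label v ≠ [] → ∃ c, (∀ w, I.G.Adj v w ↔ w = c) ∧ I.label c = [] := by
    intro v hv
    rcases hacc v with h | ⟨-, k, h⟩
    · exact absurd h.1 hv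
    · have h : heardLabels I ident v = {(k, [])} := h
      rw [hheard] at h
      obtain ⟨c, hc, he⟩ := h.ge (Set.mem_singleton _)
      obtain ⟨rfl, hl⟩ := Prod.ext_iff.1 he
      refine ⟨c, fun w => ⟨fun hw => ?_, fun hw => hw ▸ hc⟩, hl.symm⟩
      exact hid (Prod.ext_iff.1 (h.le ⟨w, hw, rfl⟩)).1
  have hcenter : ∀ v, I.label v = [] → ∃ nb : Option (Fin m) → I.V, Function.Injective nb ∧
      (∀ w, I.G.Adj v w ↔ ∃ o, w = nb o) ∧
      (∀ o, I.label (nb o) = nbrLabel (heardBits (heardLabels I ident v) m) o) ∧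
      ∀ i, ¬ (heardBits (heardLabels I ident v) m i = true ∧
        heardBits (heardLabels I ident (nb none)) m i = true) := by
    intro v hv
    rcases hacc v with ⟨-, κ, hκ, hr, y, hy, hd⟩ | ⟨⟨b, i, h⟩, -⟩
    · simp only at hr hy hd
      set x := heardBits (heardLabels I ident v) m
      rw [hheard] at hr
      have hex : ∀ o, ∃ w, I.G.Adj v w ∧ (κ o, nbrLabel x o) = (ident w, I.label w) :=
        fun o => hr.ge ⟨o, rfl⟩
      choose nb hnb hnb' using hex
      have hnbκ : ∀ o, κ o = ident (nb o) := fun o => (Prod.ext_iff.1 (hnb' o)).1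
      refine ⟨nb, fun o o' ho => hκ ?_, fun w => ⟨fun hw => ?_, ?_⟩,
        fun o => (Prod.ext_iff.1 (hnb' o)).2.symm, ?_⟩
      · rw [hnbκ, hnbκ, ho]
      · obtain ⟨o, ho⟩ := hr.le ⟨w, hw, rfl⟩
        exact ⟨o, hid ((Prod.ext_iff.1 ho).1.symm.trans (hnbκ o))⟩
      · rintro ⟨o, rfl⟩
        exact hnb o
      · obtain ⟨w, -, he⟩ := hy
        obtain ⟨h1, h2⟩ := Prod.ext_iff.1 he
        obtain rfl : nb none = w := hid ((hnbκ none).symm.trans h1)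
        rw [hm] at h2
        rwa [← List.ofFn_injective h2]
    · rw [show I.label v = leafLabel b (i + 1) from h] at hv
      simp [leafLabel] at hv
  obtain ⟨c, hc⟩ : ∃ c, I.label c = [] := by
    by_cases hv : I.label v₀ = []
    · exact ⟨v₀, hv⟩
    · obtain ⟨c, -, hc⟩ := hleaf v₀ hv
      exact ⟨c, hc⟩
  obtain ⟨nb, hinj, hadj, hlab, hdisj⟩ := hcenter c hc
  have hc' : I.label (nb none) = [] := hlab none
  obtain ⟨nb', hinj', hadj', hlab', -⟩ := hcenter (nb none) hc'
  -- `c` is a neighbor of `nb none` with an empty label, and only the entry `none` of `nb'` has one;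
  -- so the two centers designate each other.
  have hback : nb' none = c := by
    obtain ⟨_ | i, ho⟩ := (hadj' c).1 ((hadj _).2 ⟨none, rfl⟩).symm
    · exact ho.symm
    · have := hlab' (some i)
      rw [← ho, hc] at this
      simp [nbrLabel, leafLabel] at this
  refine mem_disjEdgeStar_of_local hsize (fun s => cond s (nb none) c) (fun s => cond s nb' nb)
    (fun s => heardBits (heardLabels I ident (cond s (nb none) c)) m)
    ?_ ?_ ?_ ?_ ?_ (fun v hv => (hleaf v hv).imp fun _ h => h.1) hdisj
  · rintro (_ | _) <;> assumption
  · rintro (_ | _)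
    · rfl
    · exact hback
  · rintro (_ | _) <;> assumption
  · rintro (_ | _) <;> assumption
  · rintro (_ | _) <;> assumption

end

theorem disjEdgeStar_mem_CL (N : ℕ → ℕ) : disjEdgeStar ∈ CL N :=
  ⟨edgeStarAlgorithm, 3, edgeStarAlgorithm_fitsSchedule N, fun _ _ hid =>
    ⟨edgeStarAlgorithm_allAccept_of_mem hid.1, mem_of_edgeStarAlgorithm_allAccept hid.1⟩⟩

end HybridNet

theorem mainTheorem9 (N : ℕ → ℕ) (hN : HybridNet.IsIdRange N) :
    HybridNet.disjEdgeStar ∈ HybridNet.CL N \ HybridNet.LC N ∧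
    ∀ ε : ℝ, 0 < ε → HybridNet.disjEdgeStar ∉ HybridNet.RandLC N (1 / 2 - ε) := by
  have hrand : ∀ ε : ℝ, 0 < ε → HybridNet.disjEdgeStar ∉ HybridNet.RandLC N (1 / 2 - ε) :=
    fun ε hε => HybridNet.disjEdgeStar_notMem_randLC hN.1 hε
  refine ⟨⟨HybridNet.disjEdgeStar_mem_CL N, fun h => ?_⟩, hrand⟩
  refine hrand (1 / 2) (by norm_num) ?_
  rw [sub_self]
  exact HybridNet.LC_subset_randLC N h
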